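/- Let $C\in\mathbb{R}^{n\times k}$ satisfy $\|Cu\|_2\le 1$ for all $u\in\{-1,1\}^k$, and let $G\in\mathbb{R}^{k\times d}$ have rows $G_{1},\dots,G_{k}\in\mathbb{R}^d$. Write $\|\cdot\|_F$ for the Frobenius norm. (a) Suppose $\|G_{i}\|_2\le 1$ for every $i$. If at least one of the following conditions holds, then $\|CG\|_F\le 1$: 1. $k\le 2$; 2. all entries of $C^\top C$ are non-negative; 3. the rows of $G$ are colinear, i.e. they are all scalar multiples of a single vector $v\in\mathbb{R}^d$ (in particular, if $G_{i}=u_iG_{1}$ with $u_i\in\{-1,1\}$ for all $i>1$); 4. the rows of $G$ are pairwise orthogonal, i.e. $\langle G_{i},G_{j}\rangle=0$ for all $i\ne j$. (b) If $\|G_{i}\|_2\le 1$ for every $i$, then, without any of the conditions 1–4, $\|CG\|_F\le \pi/2$. (c) If instead $\|G_{i}\|_1\le 1$ for every $i$, then, without any of the conditions 1–4, $\|CG\|_F\le 1$. -/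

import Mathlib

open scoped Matrix Matrix.Norms.Frobenius

/-!
The product `C * G` is the tensor `∑ i, c i ⊗ x i` built from the columns `c i` of `C` and the rows
`x i` of `G`, and its Frobenius norm is the norm of that tensor, so everything is a bound on
`∑ i, ∑ j, ⟪c i, c j⟫ * ⟪x i, x j⟫`. By convexity, the hypothesis on sign vectors bounds
`∑ i, u i • c i` for all `u` in the cube `[-1, 1] ^ ι`.

Under the conditions of (a), and in (c), a single point of the cube already yields a vector
`∑ i, u i • c i` at least as long as the tensor; for orthogonal families it comes from the
parallelogram law, which lets one choose signs `e` with `∑ ‖m i‖ ^ 2 ≤ ‖∑ e i • m i‖ ^ 2`.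

The bound (b) is the little Grothendieck inequality. A standard Gaussian vector `g` produces the
random vector `q = ∑ i, ⟪x i, g⟫ • c i`, with `𝔼 ‖q‖ ^ 2` equal to the squared norm `S` of the
tensor. Rietz's roundings `‖x i‖ * sign ⟪x i, g⟫` lie in `[-1, 1]`, and the vector `p` that they
produce satisfies `𝔼 ⟪p, q⟫ = √(2 / π) * S`, so expanding `0 ≤ 𝔼 ‖p - √(2 / π) • q‖ ^ 2` gives
`S ≤ π / 2`.
-/

open MeasureTheory ProbabilityTheory
open scoped NNReal RealInnerProductSpace TensorProduct

section Signs

variable {ι H : Type*} [Fintype ι] [NormedAddCommGroup H]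

lemma norm_sum_smul_le_of_forall_sign [NormedSpace ℝ H] {c : ι → H} {M : ℝ}
    (hc : ∀ u : ι → ℝ, (∀ i, u i = -1 ∨ u i = 1) → ‖∑ i, u i • c i‖ ≤ M)
    {u : ι → ℝ} (hu : ∀ i, |u i| ≤ 1) : ‖∑ i, u i • c i‖ ≤ M := by
  have hmem : u ∈ convexHull ℝ (Set.univ.pi fun _ : ι => ({-1, 1} : Set ℝ)) := by
    refine mem_convexHull_pi fun i _ => ?_
    rw [convexHull_pair, segment_eq_Icc (by norm_num)]
    exact abs_le.1 (hu i)
  obtain ⟨w, hw, hle⟩ := ((convexOn_univ_norm (E := H)).comp_linearMap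
    (Fintype.linearCombination ℝ c)).exists_ge_of_mem_convexHull (Set.subset_univ _) hmem
  exact hle.trans (hc w fun i => by simpa using hw i (Set.mem_univ i))

variable [InnerProductSpace ℝ H]

lemma exists_sign_sum_norm_sq_le (m : ι → H) :
    ∃ e : ι → ℝ, (∀ i, e i = -1 ∨ e i = 1) ∧ ∑ i, ‖m i‖ ^ 2 ≤ ‖∑ i, e i • m i‖ ^ 2 := by
  classical
  suffices h : ∀ s : Finset ι, ∃ e : ι → ℝ, (∀ i, e i = -1 ∨ e i = 1) ∧
      ∑ i ∈ s, ‖m i‖ ^ 2 ≤ ‖∑ i ∈ s, e i • m i‖ ^ 2 from h Finset.univ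
  intro s
  induction s using Finset.induction_on with
  | empty => exact ⟨fun _ => 1, by simp, by simp⟩
  | insert a s ha ih =>
    obtain ⟨e, he, hle⟩ := ih
    obtain ⟨r, hr, hinner⟩ : ∃ r : ℝ, (r = -1 ∨ r = 1) ∧ 0 ≤ r * ⟪m a, ∑ i ∈ s, e i • m i⟫ := by
      rcases le_total 0 ⟪m a, ∑ i ∈ s, e i • m i⟫ with h | h
      · exact ⟨1, .inr rfl, by simpa⟩
      · exact ⟨-1, .inl rfl, by simpa⟩
    refine ⟨Function.update e a r, fun i => ?_, ?_⟩
    · rcases eq_or_ne i a with rfl | hi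
      · simpa
      · simpa [hi] using he i
    · have hsum : ∑ i ∈ s, Function.update e a r i • m i = ∑ i ∈ s, e i • m i :=
        Finset.sum_congr rfl fun i hi => by
          rw [Function.update_of_ne (ne_of_mem_of_not_mem hi ha)]
      have hnorm : ‖r • m a‖ ^ 2 = ‖m a‖ ^ 2 := by rcases hr with rfl | rfl <;> simp
      rw [Finset.sum_insert ha, Finset.sum_insert ha, hsum, Function.update_self,
        norm_add_sq_real, hnorm, real_inner_smul_left]
      linarith

lemma exists_sign_mul_inner_nonneg_of_card_le_two (hι : Fintype.card ι ≤ 2) (c : ι → H) :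
    ∃ u : ι → ℝ, (∀ i, u i = -1 ∨ u i = 1) ∧ ∀ i j, 0 ≤ u i * u j * ⟪c i, c j⟫ := by
  classical
  by_cases! hpos : ∀ i j, 0 ≤ ⟪c i, c j⟫
  · exact ⟨fun _ => 1, by simp, by simpa using hpos⟩
  obtain ⟨a, b, hab⟩ := hpos
  have hne : a ≠ b := by
    rintro rfl
    exact hab.not_ge real_inner_self_nonneg
  have hcover (i : ι) : i = a ∨ i = b := by
    by_contra! hi
    exact hι.not_gt (Fintype.two_lt_card_iff.2 ⟨i, a, b, hi.1, hi.2, hne⟩)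
  refine ⟨fun i => if i = a then -1 else 1, fun i => ite_eq_or_eq _ _ _, fun i j => ?_⟩
  have hba : ⟪c b, c a⟫ ≤ 0 := by rw [real_inner_comm]; exact hab.le
  rcases hcover i with rfl | rfl <;> rcases hcover j with rfl | rfl <;>
    simp [hne.symm, hab.le, hba]

end Signs

section Tensor

variable {ι H E : Type*} [Fintype ι] [NormedAddCommGroup H] [InnerProductSpace ℝ H]
  [NormedAddCommGroup E] [InnerProductSpace ℝ E]

lemma real_inner_sum_smul_sum_smul (a b : ι → ℝ) (c : ι → H) :
    ⟪∑ i, a i • c i, ∑ j, b j • c j⟫ = ∑ i, ∑ j, ⟪c i, c j⟫ * (a i * b j) := by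
  simp_rw [sum_inner, inner_sum, real_inner_smul_left, real_inner_smul_right]
  exact Finset.sum_congr rfl fun i _ => Finset.sum_congr rfl fun j _ => by ring

lemma norm_sq_sum_tmul (c : ι → H) (x : ι → E) :
    ‖∑ i, c i ⊗ₜ[ℝ] x i‖ ^ 2 = ∑ i, ∑ j, ⟪c i, c j⟫ * ⟪x i, x j⟫ := by
  rw [← real_inner_self_eq_norm_sq, sum_inner]
  simp_rw [inner_sum, TensorProduct.inner_tmul]

lemma norm_sq_sum_tmul_of_pairwise_inner_eq_zero (c : ι → H) {x : ι → E}
    (hx : ∀ i j, i ≠ j → ⟪x i, x j⟫ = 0) :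
    ‖∑ i, c i ⊗ₜ[ℝ] x i‖ ^ 2 = ∑ i, ‖c i‖ ^ 2 * ‖x i‖ ^ 2 := by
  rw [norm_sq_sum_tmul]
  refine Finset.sum_congr rfl fun i _ => ?_
  rw [Fintype.sum_eq_single i fun j hj => by rw [hx i j hj.symm, mul_zero],
    real_inner_self_eq_norm_sq, real_inner_self_eq_norm_sq]

lemma norm_sq_sum_tmul_eq_sum_norm_sq {κ : Type*} [Fintype κ] (b : OrthonormalBasis κ ℝ E)
    (c : ι → H) (x : ι → E) :
    ‖∑ i, c i ⊗ₜ[ℝ] x i‖ ^ 2 = ∑ t, ‖∑ i, ⟪b t, x i⟫ • c i‖ ^ 2 := by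
  have hexpand : ∑ i, c i ⊗ₜ[ℝ] x i = ∑ t, (∑ i, ⟪b t, x i⟫ • c i) ⊗ₜ[ℝ] b t := by
    simp_rw [TensorProduct.sum_tmul, TensorProduct.smul_tmul]
    rw [Finset.sum_comm]
    simp_rw [← TensorProduct.tmul_sum, b.sum_repr']
  rw [hexpand, norm_sq_sum_tmul_of_pairwise_inner_eq_zero _ fun s t hst => b.orthonormal.2 hst]
  simp

lemma norm_sum_tmul_le_norm_sum_smul_of_mul_inner_nonneg {c : ι → H} {u : ι → ℝ}
    (hu : ∀ i, u i = -1 ∨ u i = 1) (hpos : ∀ i j, 0 ≤ u i * u j * ⟪c i, c j⟫) {x : ι → E}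
    (hx : ∀ i, ‖x i‖ ≤ 1) :
    ‖∑ i, c i ⊗ₜ[ℝ] x i‖ ≤ ‖∑ i, u i • c i‖ := by
  refine (sq_le_sq₀ (norm_nonneg _) (norm_nonneg _)).1 ?_
  rw [norm_sq_sum_tmul, ← real_inner_self_eq_norm_sq, real_inner_sum_smul_sum_smul]
  refine Finset.sum_le_sum fun i _ => Finset.sum_le_sum fun j _ => ?_
  have hx_abs : |⟪x i, x j⟫| ≤ 1 :=
    (abs_real_inner_le_norm _ _).trans (mul_le_one₀ (hx i) (norm_nonneg _) (hx j))
  have hu_abs : |u i * u j| = 1 := by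
    rcases hu i with h | h <;> rcases hu j with h' | h' <;> simp [h, h']
  calc ⟪c i, c j⟫ * ⟪x i, x j⟫ ≤ |⟪c i, c j⟫| * |⟪x i, x j⟫| := by
        rw [← abs_mul]; exact le_abs_self _
    _ ≤ |⟪c i, c j⟫| := mul_le_of_le_one_right (abs_nonneg _) hx_abs
    _ = |u i * u j * ⟪c i, c j⟫| := by rw [abs_mul (u i * u j), hu_abs, one_mul]
    _ = ⟪c i, c j⟫ * (u i * u j) := by rw [abs_of_nonneg (hpos i j), mul_comm]

section CubeBound

variable {c : ι → H} {M : ℝ}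
  (hc : ∀ u : ι → ℝ, (∀ i, u i = -1 ∨ u i = 1) → ‖∑ i, u i • c i‖ ≤ M)
include hc

lemma norm_sum_tmul_smul_le {a : ι → ℝ} {v : E} (ha : ∀ i, ‖a i • v‖ ≤ 1) :
    ‖∑ i, c i ⊗ₜ[ℝ] (a i • v)‖ ≤ M := by
  have hcube (i : ι) : |‖v‖ * a i| ≤ 1 := by
    rw [abs_mul, abs_norm, mul_comm, ← Real.norm_eq_abs, ← norm_smul]
    exact ha i
  calc ‖∑ i, c i ⊗ₜ[ℝ] (a i • v)‖ = ‖(∑ i, a i • c i) ⊗ₜ[ℝ] v‖ := by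
        simp_rw [TensorProduct.sum_tmul, TensorProduct.smul_tmul]
    _ = ‖∑ i, (‖v‖ * a i) • c i‖ := by
        simp_rw [mul_smul, ← Finset.smul_sum]
        rw [TensorProduct.norm_tmul, norm_smul, norm_norm, mul_comm]
    _ ≤ M := norm_sum_smul_le_of_forall_sign hc hcube

lemma norm_sum_tmul_le_of_pairwise_inner_eq_zero {x : ι → E} (hx : ∀ i, ‖x i‖ ≤ 1)
    (horth : ∀ i j, i ≠ j → ⟪x i, x j⟫ = 0) : ‖∑ i, c i ⊗ₜ[ℝ] x i‖ ≤ M := by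
  obtain ⟨e, he, hle⟩ := exists_sign_sum_norm_sq_le fun i => ‖x i‖ • c i
  have hcube (i : ι) : |e i * ‖x i‖| ≤ 1 := by
    rcases he i with h | h <;> simpa [h] using hx i
  refine le_trans ((sq_le_sq₀ (norm_nonneg _) (norm_nonneg _)).1 ?_)
    (norm_sum_smul_le_of_forall_sign hc hcube)
  rw [norm_sq_sum_tmul_of_pairwise_inner_eq_zero c horth]
  simpa only [norm_smul, norm_norm, mul_pow, mul_comm (‖x _‖ ^ 2), smul_smul] using hle

lemma norm_sum_tmul_le_of_sum_abs_inner_le_one {κ : Type*} [Fintype κ]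
    (b : OrthonormalBasis κ ℝ E) {x : ι → E} (hx : ∀ i, ∑ t, |⟪b t, x i⟫| ≤ 1) :
    ‖∑ i, c i ⊗ₜ[ℝ] x i‖ ≤ M := by
  obtain ⟨e, he, hle⟩ := exists_sign_sum_norm_sq_le fun t => ∑ i, ⟪b t, x i⟫ • c i
  have hcube (i : ι) : |∑ t, e t * ⟪b t, x i⟫| ≤ 1 := by
    refine (Finset.abs_sum_le_sum_abs _ _).trans (le_trans (Finset.sum_le_sum fun t _ => ?_) (hx i))
    rcases he t with h | h <;> simp [h]
  have hsum : ∑ t, e t • ∑ i, ⟪b t, x i⟫ • c i = ∑ i, (∑ t, e t * ⟪b t, x i⟫) • c i := by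
    simp_rw [Finset.smul_sum, Finset.sum_smul, smul_smul]
    exact Finset.sum_comm
  refine le_trans ((sq_le_sq₀ (norm_nonneg _) (norm_nonneg _)).1 ?_)
    (norm_sum_smul_le_of_forall_sign hc hcube)
  rwa [norm_sq_sum_tmul_eq_sum_norm_sq b, ← hsum]

end CubeBound

end Tensor

section Gaussian

lemma integral_abs_gaussianReal_zero (v : ℝ≥0) :
    ∫ t, |t| ∂gaussianReal 0 v = √(2 / Real.pi) * √v := by
  rcases eq_or_ne v 0 with rfl | hv
  · simp
  have hv_pos : (0 : ℝ) < v := by positivity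
  have hdensity (t : ℝ) : gaussianPDFReal 0 v t • |t| =
      (√(2 * Real.pi * v))⁻¹ * (|t| ^ (1 : ℝ) * Real.exp (-(2 * v : ℝ)⁻¹ * |t| ^ (2 : ℝ))) := by
    have hexponent : -t ^ 2 / (2 * v) = -(2 * v : ℝ)⁻¹ * t ^ 2 := by ring
    rw [gaussianPDFReal, sub_zero, hexponent, smul_eq_mul, Real.rpow_one, Real.rpow_two, sq_abs]
    ring
  have hmoment : ∫ s in Set.Ioi 0, s ^ (1 : ℝ) * Real.exp (-(2 * v : ℝ)⁻¹ * s ^ (2 : ℝ)) = v := by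
    rw [integral_rpow_mul_exp_neg_mul_rpow (by norm_num) (by norm_num) (by positivity),
      show -((1 : ℝ) + 1) / 2 = -1 by norm_num,
      show ((1 : ℝ) + 1) / 2 = 1 by norm_num, Real.Gamma_one, Real.rpow_neg_one, inv_inv]
    ring
  calc ∫ t, |t| ∂gaussianReal 0 v = 2 * ((√(2 * Real.pi * v))⁻¹ * v) := by
        rw [integral_gaussianReal_eq_integral_smul hv]
        simp_rw [hdensity]
        rw [integral_const_mul, integral_comp_abs
          (f := fun s => s ^ (1 : ℝ) * Real.exp (-(2 * v : ℝ)⁻¹ * s ^ (2 : ℝ))), hmoment]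
        ring
    _ = √(2 / Real.pi) * √v := by
        rw [Real.sqrt_mul (by positivity), Real.sqrt_mul zero_le_two,
          Real.sqrt_div zero_le_two]
        field_simp
        rw [Real.sq_sqrt hv_pos.le, Real.sq_sqrt zero_le_two]

lemma measurable_coe_sign : Measurable fun t : ℝ => (SignType.sign t : ℝ) := by
  have hcoe : Monotone ((↑) : SignType → ℝ) := by
    rintro (_ | _ | _) (_ | _ | _) h <;> first | exact absurd h (by decide) | simp
  exact (hcoe.comp SignType.sign.monotone).measurable

lemma abs_coe_sign_le_one (t : ℝ) : |(SignType.sign t : ℝ)| ≤ 1 := by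
  rcases SignType.sign t with _ | _ | _ <;> simp

variable {E : Type*} [NormedAddCommGroup E] [InnerProductSpace ℝ E]

/-- Rietz's rounding of `x` along `g`: it replaces the coefficient `⟪x, g⟫` by one of the same sign
that is bounded independently of `g`. The factor `‖x‖` makes its correlation with a Gaussian
functional `⟪y, g⟫` bilinear in `x` and `y`. -/
noncomputable def rietzRounding (x g : E) : ℝ := ‖x‖ * SignType.sign ⟪x, g⟫

lemma abs_rietzRounding_le (x g : E) : |rietzRounding x g| ≤ ‖x‖ := by
  rw [rietzRounding, abs_mul, abs_norm]
  exact mul_le_of_le_one_right (norm_nonneg x) (abs_coe_sign_le_one _)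

variable [FiniteDimensional ℝ E] [MeasurableSpace E] [BorelSpace E]

lemma memLp_inner_stdGaussian (x : E) : MemLp (fun g => ⟪x, g⟫) 2 (stdGaussian E) :=
  IsGaussian.memLp_dual _ (innerSL ℝ x) 2 (by simp)

lemma integrable_inner_stdGaussian (x : E) : Integrable (fun g => ⟪x, g⟫) (stdGaussian E) :=
  (memLp_inner_stdGaussian x).integrable (by norm_num)

lemma integrable_inner_mul_inner_stdGaussian (x y : E) :
    Integrable (fun g => ⟪x, g⟫ * ⟪y, g⟫) (stdGaussian E) :=
  (memLp_inner_stdGaussian x).integrable_mul (memLp_inner_stdGaussian y)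

lemma integral_inner_mul_inner_stdGaussian (x y : E) :
    ∫ g, ⟪x, g⟫ * ⟪y, g⟫ ∂stdGaussian E = ⟪x, y⟫ := by
  have h := covarianceBilin_apply (μ := stdGaussian E) IsGaussian.memLp_two_id x y
  rw [covarianceBilin_stdGaussian, innerSL_apply_apply ℝ] at h
  simpa using h.symm

lemma integral_abs_inner_stdGaussian (x : E) :
    ∫ g, |⟪x, g⟫| ∂stdGaussian E = √(2 / Real.pi) * ‖x‖ := by
  have hmap := IsGaussian.map_eq_gaussianReal (μ := stdGaussian E) (innerSL ℝ x)
  rw [integral_strongDual_stdGaussian, variance_dual_stdGaussian, innerSL_apply_norm] at hmap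
  calc ∫ g, |⟪x, g⟫| ∂stdGaussian E = ∫ t, |t| ∂((stdGaussian E).map (innerSL ℝ x)) :=
        (integral_map (φ := innerSL ℝ x) (by fun_prop) (by fun_prop)).symm
    _ = √(2 / Real.pi) * ‖x‖ := by rw [hmap, integral_abs_gaussianReal_zero]; simp

lemma integral_comp_linearIsometryEquiv_stdGaussian {V : Type*} [NormedAddCommGroup V]
    [NormedSpace ℝ V] (f : E ≃ₗᵢ[ℝ] E) (φ : E → V) :
    ∫ g, φ (f g) ∂stdGaussian E = ∫ g, φ g ∂stdGaussian E := by
  conv_rhs => rw [← stdGaussian_map f]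
  exact (f.toHomeomorph.measurableEmbedding.integral_map φ).symm

lemma integrable_sign_inner_mul_inner_stdGaussian (x y : E) :
    Integrable (fun g => (SignType.sign ⟪x, g⟫ : ℝ) * ⟪y, g⟫) (stdGaussian E) :=
  (integrable_inner_stdGaussian y).bdd_mul (c := 1)
    (measurable_coe_sign.comp (by fun_prop)).aestronglyMeasurable
    (.of_forall fun _ => abs_coe_sign_le_one _)

lemma integral_sign_inner_mul_inner_of_inner_eq_zero {x y : E} (hxy : ⟪x, y⟫ = 0) :
    ∫ g, (SignType.sign ⟪x, g⟫ : ℝ) * ⟪y, g⟫ ∂stdGaussian E = 0 := by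
  -- The reflection in the line through `x` fixes `⟪x, g⟫` and negates `⟪y, g⟫`.
  let f : E ≃ₗᵢ[ℝ] E := (ℝ ∙ x).reflection
  have hfx : f x = x :=
    Submodule.reflection_mem_subspace_eq_self (Submodule.mem_span_singleton_self x)
  have hfy : f y = -y := Submodule.reflection_mem_subspace_orthogonalComplement_eq_neg
    (Submodule.mem_orthogonal_singleton_iff_inner_right.2 hxy)
  have hx (g : E) : ⟪x, f g⟫ = ⟪x, g⟫ := by rw [← f.inner_map_map x g, hfx]
  have hy (g : E) : ⟪y, f g⟫ = -⟪y, g⟫ := by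
    rw [← f.inner_map_map y g, hfy, inner_neg_left, neg_neg]
  have h := integral_comp_linearIsometryEquiv_stdGaussian f
    fun g => (SignType.sign ⟪x, g⟫ : ℝ) * ⟪y, g⟫
  simp_rw [hx, hy, mul_neg, integral_neg] at h
  linarith

lemma integrable_rietzRounding_mul_inner (x y : E) :
    Integrable (fun g => rietzRounding x g * ⟪y, g⟫) (stdGaussian E) := by
  simp_rw [rietzRounding, mul_assoc]
  exact (integrable_sign_inner_mul_inner_stdGaussian x y).const_mul _

lemma integral_rietzRounding_mul_inner (x y : E) :
    ∫ g, rietzRounding x g * ⟪y, g⟫ ∂stdGaussian E = √(2 / Real.pi) * ⟪x, y⟫ := by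
  obtain ⟨_, hspan, w, hw, rfl⟩ := (ℝ ∙ x).exists_add_mem_mem_orthogonal y
  obtain ⟨a, rfl⟩ := Submodule.mem_span_singleton.1 hspan
  rw [Submodule.mem_orthogonal_singleton_iff_inner_right] at hw
  have hsplit (g : E) : rietzRounding x g * ⟪a • x + w, g⟫ =
      ‖x‖ * (a * |⟪x, g⟫| + SignType.sign ⟪x, g⟫ * ⟪w, g⟫) := by
    rw [rietzRounding, ← sign_mul_self, inner_add_left, real_inner_smul_left]
    ring
  simp_rw [hsplit]
  rw [integral_const_mul, integral_add ((integrable_inner_stdGaussian x).abs.const_mul a)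
    (integrable_sign_inner_mul_inner_stdGaussian x w), integral_const_mul,
    integral_abs_inner_stdGaussian, integral_sign_inner_mul_inner_of_inner_eq_zero hw,
    inner_add_right, real_inner_smul_right, real_inner_self_eq_norm_sq, hw]
  ring

end Gaussian

section RandomSums

variable {ι H Ω : Type*} [Fintype ι] [NormedAddCommGroup H] [InnerProductSpace ℝ H]
  [MeasurableSpace Ω] {μ : Measure Ω} {a b : ι → Ω → ℝ}

lemma integrable_inner_sum_smul_sum_smul
    (hab : ∀ i j, Integrable (fun ω => a i ω * b j ω) μ) (c : ι → H) :
    Integrable (fun ω => ⟪∑ i, a i ω • c i, ∑ j, b j ω • c j⟫) μ := by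
  simp_rw [real_inner_sum_smul_sum_smul]
  exact integrable_finsetSum _ fun i _ => integrable_finsetSum _ fun j _ => (hab i j).const_mul _

lemma integral_inner_sum_smul_sum_smul
    (hab : ∀ i j, Integrable (fun ω => a i ω * b j ω) μ) (c : ι → H) :
    ∫ ω, ⟪∑ i, a i ω • c i, ∑ j, b j ω • c j⟫ ∂μ =
      ∑ i, ∑ j, ⟪c i, c j⟫ * ∫ ω, a i ω * b j ω ∂μ := by
  have hterm (i j : ι) := (hab i j).const_mul ⟪c i, c j⟫
  simp_rw [real_inner_sum_smul_sum_smul]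
  rw [integral_finsetSum _ fun i _ => integrable_finsetSum _ fun j _ => hterm i j]
  refine Finset.sum_congr rfl fun i _ => ?_
  rw [integral_finsetSum _ fun j _ => hterm i j]
  simp_rw [integral_const_mul]

end RandomSums

section LittleGrothendieck

variable {ι H E : Type*} [Fintype ι] [NormedAddCommGroup H] [InnerProductSpace ℝ H]
  [NormedAddCommGroup E] [InnerProductSpace ℝ E]

lemma two_mul_inner_le_norm_sq_add (r : ℝ) (p q : H) :
    2 * r * ⟪p, q⟫ ≤ ‖p‖ ^ 2 + r ^ 2 * ‖q‖ ^ 2 := by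
  have h : ‖p - r • q‖ ^ 2 = ‖p‖ ^ 2 - 2 * (r * ⟪p, q⟫) + r ^ 2 * ‖q‖ ^ 2 := by
    rw [norm_sub_sq_real, real_inner_smul_right, norm_smul, mul_pow, Real.norm_eq_abs, sq_abs]
  linarith [sq_nonneg ‖p - r • q‖]

lemma norm_sum_rietzRounding_smul_le {c : ι → H} {M : ℝ}
    (hc : ∀ u : ι → ℝ, (∀ i, u i = -1 ∨ u i = 1) → ‖∑ i, u i • c i‖ ≤ M)
    {x : ι → E} (hx : ∀ i, ‖x i‖ ≤ 1) (g : E) : ‖∑ i, rietzRounding (x i) g • c i‖ ≤ M :=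
  norm_sum_smul_le_of_forall_sign hc fun i => (abs_rietzRounding_le _ _).trans (hx i)

variable [FiniteDimensional ℝ E]

section Moments

variable [MeasurableSpace E] [BorelSpace E]

lemma integrable_norm_sq_sum_inner_smul (c : ι → H) (x : ι → E) :
    Integrable (fun g => ‖∑ i, ⟪x i, g⟫ • c i‖ ^ 2) (stdGaussian E) := by
  simp_rw [← real_inner_self_eq_norm_sq]
  exact integrable_inner_sum_smul_sum_smul
    (fun i j => integrable_inner_mul_inner_stdGaussian (x i) (x j)) c

lemma integral_norm_sq_sum_inner_smul (c : ι → H) (x : ι → E) :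
    ∫ g, ‖∑ i, ⟪x i, g⟫ • c i‖ ^ 2 ∂stdGaussian E = ‖∑ i, c i ⊗ₜ[ℝ] x i‖ ^ 2 := by
  simp_rw [← real_inner_self_eq_norm_sq (∑ i, ⟪x i, _⟫ • c i)]
  rw [integral_inner_sum_smul_sum_smul
    (fun i j => integrable_inner_mul_inner_stdGaussian (x i) (x j)), norm_sq_sum_tmul]
  simp_rw [integral_inner_mul_inner_stdGaussian]

lemma integral_inner_sum_rietzRounding_smul_sum_inner_smul (c : ι → H) (x : ι → E) :
    ∫ g, ⟪∑ i, rietzRounding (x i) g • c i, ∑ j, ⟪x j, g⟫ • c j⟫ ∂stdGaussian E =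
      √(2 / Real.pi) * ‖∑ i, c i ⊗ₜ[ℝ] x i‖ ^ 2 := by
  rw [integral_inner_sum_smul_sum_smul
    (fun i j => integrable_rietzRounding_mul_inner (x i) (x j)), norm_sq_sum_tmul]
  simp_rw [integral_rietzRounding_mul_inner, Finset.mul_sum, mul_left_comm]

end Moments

lemma norm_sum_tmul_le_sqrt_pi_div_two_mul {c : ι → H} {M : ℝ}
    (hc : ∀ u : ι → ℝ, (∀ i, u i = -1 ∨ u i = 1) → ‖∑ i, u i • c i‖ ≤ M)
    {x : ι → E} (hx : ∀ i, ‖x i‖ ≤ 1) : ‖∑ i, c i ⊗ₜ[ℝ] x i‖ ≤ √(Real.pi / 2) * M := by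
  borelize E
  set S := ‖∑ i, c i ⊗ₜ[ℝ] x i‖ ^ 2
  set r := √(2 / Real.pi)
  let p (g : E) : H := ∑ i, rietzRounding (x i) g • c i
  let q (g : E) : H := ∑ j, ⟪x j, g⟫ • c j
  have hM : 0 ≤ M := (norm_nonneg _).trans (norm_sum_rietzRounding_smul_le hc hx 0)
  have hpointwise (g : E) : 2 * r * ⟪p g, q g⟫ ≤ M ^ 2 + r ^ 2 * ‖q g‖ ^ 2 :=
    (two_mul_inner_le_norm_sq_add r (p g) (q g)).trans <| by
      gcongr
      exact norm_sum_rietzRounding_smul_le hc hx g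
  have hpq_int : Integrable (fun g => ⟪p g, q g⟫) (stdGaussian E) :=
    integrable_inner_sum_smul_sum_smul
      (fun i j => integrable_rietzRounding_mul_inner (x i) (x j)) c
  have hq_int : Integrable (fun g => ‖q g‖ ^ 2) (stdGaussian E) :=
    integrable_norm_sq_sum_inner_smul c x
  have hmean : 2 * r * (r * S) ≤ M ^ 2 + r ^ 2 * S :=
    calc 2 * r * (r * S) = ∫ g, 2 * r * ⟪p g, q g⟫ ∂stdGaussian E := by
          rw [integral_const_mul, integral_inner_sum_rietzRounding_smul_sum_inner_smul]
      _ ≤ ∫ g, (M ^ 2 + r ^ 2 * ‖q g‖ ^ 2) ∂stdGaussian E :=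
          integral_mono (hpq_int.const_mul _)
            ((integrable_const _).add (hq_int.const_mul _)) hpointwise
      _ = M ^ 2 + r ^ 2 * S := by
          rw [integral_add (integrable_const _) (hq_int.const_mul _), integral_const_mul,
            integral_norm_sq_sum_inner_smul, integral_const, probReal_univ, one_smul]
  have hS : S ≤ Real.pi / 2 * M ^ 2 := by
    have hr : r ^ 2 = 2 / Real.pi := Real.sq_sqrt (by positivity)
    calc S = Real.pi / 2 * (r ^ 2 * S) := by rw [hr]; field_simp
      _ ≤ Real.pi / 2 * M ^ 2 := by gcongr; linarith
  refine (sq_le_sq₀ (norm_nonneg _) (by positivity)).1 ?_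
  rwa [mul_pow, Real.sq_sqrt (by positivity)]

end LittleGrothendieck

section Matrix

variable {l m n : Type*}

lemma inner_toLp_col_toLp_col [Fintype l] (C : Matrix l m ℝ) (i j : m) :
    ⟪WithLp.toLp 2 (C.col i), WithLp.toLp 2 (C.col j)⟫ = (Cᵀ * C) i j := by
  simp [PiLp.inner_apply, Matrix.mul_apply, mul_comm]

lemma toLp_mulVec_eq_sum_smul_col {R : Type*} [CommRing R] [Fintype m] (A : Matrix l m R)
    (u : m → R) : WithLp.toLp 2 (A *ᵥ u) = ∑ j, u j • WithLp.toLp 2 (A.col j) := by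
  ext i
  simp [Matrix.mulVec, dotProduct, mul_comm]

lemma frobenius_norm_sq_eq_sum_norm_sq_col {α : Type*} [SeminormedAddCommGroup α] [Fintype l]
    [Fintype n] (A : Matrix l n α) : ‖A‖ ^ 2 = ∑ t, ‖WithLp.toLp 2 (A.col t)‖ ^ 2 := by
  rw [Matrix.frobenius_norm_def, ← Real.sqrt_eq_rpow, Real.sq_sqrt (by positivity),
    Finset.sum_comm]
  simp [PiLp.norm_sq_eq_of_L2]

variable [Fintype l] [Fintype m] [Fintype n]

lemma frobenius_norm_mul_eq_norm_sum_tmul (C : Matrix l m ℝ) (G : Matrix m n ℝ) :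
    ‖C * G‖ = ‖∑ i, WithLp.toLp 2 (C.col i) ⊗ₜ[ℝ] WithLp.toLp 2 (G.row i)‖ := by
  classical
  refine (sq_eq_sq₀ (norm_nonneg _) (norm_nonneg _)).1 ?_
  rw [norm_sq_sum_tmul_eq_sum_norm_sq (EuclideanSpace.basisFun n ℝ),
    frobenius_norm_sq_eq_sum_norm_sq_col]
  refine Finset.sum_congr rfl fun t _ => ?_
  have hcol : (C * G).col t = C *ᵥ G.col t := rfl
  rw [hcol, toLp_mulVec_eq_sum_smul_col]
  simp [EuclideanSpace.basisFun_apply, EuclideanSpace.inner_single_left]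

theorem mainTheorem3_general (C : Matrix l m ℝ)
    (hC : ∀ u : m → ℝ, (∀ i, u i = -1 ∨ u i = 1) → ‖WithLp.toLp 2 (C *ᵥ u)‖ ≤ 1)
    (G : Matrix m n ℝ) :
    ((∀ i, ‖WithLp.toLp 2 (G.row i)‖ ≤ 1) →
      ((Fintype.card m ≤ 2 ∨
        (∀ i j, 0 ≤ (Cᵀ * C) i j) ∨
        (∃ v : n → ℝ, ∀ i, ∃ a : ℝ, G.row i = a • v) ∨
        (∀ i j, i ≠ j → G.row i ⬝ᵥ G.row j = 0)) → ‖C * G‖ ≤ 1) ∧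
      ‖C * G‖ ≤ √(Real.pi / 2)) ∧
    ((∀ i, ‖WithLp.toLp 1 (G.row i)‖ ≤ 1) → ‖C * G‖ ≤ 1) := by
  simp only [toLp_mulVec_eq_sum_smul_col] at hC
  simp only [frobenius_norm_mul_eq_norm_sum_tmul, ← inner_toLp_col_toLp_col]
  refine ⟨fun hG => ⟨?_, ?_⟩, fun hG => ?_⟩
  · rintro (hcard | hnonneg | ⟨v, hv⟩ | horth)
    · obtain ⟨u, hu, hpos⟩ := exists_sign_mul_inner_nonneg_of_card_le_two hcard
        fun i => WithLp.toLp 2 (C.col i)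
      exact (norm_sum_tmul_le_norm_sum_smul_of_mul_inner_nonneg hu hpos hG).trans (hC u hu)
    · exact (norm_sum_tmul_le_norm_sum_smul_of_mul_inner_nonneg (u := fun _ => 1) (by simp)
        (by simpa using hnonneg) hG).trans (hC _ (by simp))
    · choose a ha using hv
      simp only [ha, WithLp.toLp_smul] at hG ⊢
      exact norm_sum_tmul_smul_le hC hG
    · refine norm_sum_tmul_le_of_pairwise_inner_eq_zero hC hG fun i j hij => ?_
      simpa [EuclideanSpace.inner_toLp_toLp] using horth j i hij.symm
  · simpa only [mul_one] using norm_sum_tmul_le_sqrt_pi_div_two_mul hC hG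
  · classical
    refine norm_sum_tmul_le_of_sum_abs_inner_le_one hC (EuclideanSpace.basisFun n ℝ) fun i => ?_
    simpa [PiLp.norm_eq_of_L1, EuclideanSpace.basisFun_apply,
      EuclideanSpace.inner_single_left] using hG i

end Matrix

theorem mainTheorem3 (n k d : ℕ) (C : Matrix (Fin n) (Fin k) ℝ)
    (hC : ∀ u : Fin k → ℝ, (∀ i, u i = -1 ∨ u i = 1) → ‖WithLp.toLp 2 (C *ᵥ u)‖ ≤ 1)
    (G : Matrix (Fin k) (Fin d) ℝ) :
    ((∀ i, ‖WithLp.toLp 2 (G.row i)‖ ≤ 1) →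
      ((k ≤ 2 ∨
        (∀ i j, 0 ≤ (Cᵀ * C) i j) ∨
        (∃ v : Fin d → ℝ, ∀ i, ∃ a : ℝ, G.row i = a • v) ∨
        (∀ i j, i ≠ j → G.row i ⬝ᵥ G.row j = 0)) → ‖C * G‖ ≤ 1) ∧
      ‖C * G‖ ≤ Real.pi / 2) ∧
    ((∀ i, ‖WithLp.toLp 1 (G.row i)‖ ≤ 1) → ‖C * G‖ ≤ 1) := by
  have hsqrt : √(Real.pi / 2) ≤ Real.pi / 2 :=
    Real.sqrt_le_self_iff.2 (.inr (by linarith [Real.two_le_pi]))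
  simpa only [Fintype.card_fin] using
    (mainTheorem3_general C hC G).imp_left fun h hG => (h hG).imp_right hsqrt.trans'
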